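/- Consider the scheduling problem $P\,|\,\mathit{partition},\mathit{prmp}\,|\,\sum_j C_j$. An instance consists of $m\ge 1$ identical machines and a finite set $J$ of jobs, where job $j$ has a real processing time $p_j>0$ and uses exactly one resource $r_j$, so that the resources partition $J$. A (preemptive) schedule consists of finitely many job parts, each of which processes one job on one machine during a time interval of positive length that starts at time $0$ or later; a job may be interrupted at any time and resumed later, possibly on another machine, and its job parts are the maximal intervals in which it is processed without interruption on a single machine. The schedule is feasible if each machine processes at most one job at a time, no job is processed on two machines at the same time, two jobs that use the same resource are never processed at the same time, and the lengths of the job parts of each job $j$ add up to $p_j$. The completion time $C_j$ is the time at which the last job part of $j$ ends. A schedule is optimal if it is feasible and minimizes $\sum_{j\in J} C_j$ over all feasible preemptive schedules. Theorem. Every instance of $P\,|\,\mathit{partition},\mathit{prmp}\,|\,\sum_j C_j$ has an optimal schedule without preemptions, i.e. an optimal schedule in which every job is processed without interruption on a single machine (it consists of exactly one job part). -/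

import Mathlib

/-- An instance of `P | partition, prmp | ∑ C_j` with job set `J`: `m` identical machines, positive
processing times `p`, and for every job the one resource it uses. The fibres of `resource` are the
classes of the partition of the jobs; there is one unit of each resource. -/
structure PartitionInstance (J R : Type*) where
  m : ℕ
  m_pos : 0 < m
  p : J → ℝ
  p_pos : ∀ j, 0 < p j
  resource : J → R

/-- A part of a job: `job` is processed on machine `machine` during the time interval
from `start` to `finish`. -/
structure JobPart (J : Type*) (m : ℕ) where
  job : J
  machine : Fin m
  start : ℝ
  finish : ℝ

/-- A feasible preemptive schedule, given by its finitely many job parts. -/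
structure PreemptiveSchedule {J R : Type*} [DecidableEq J] (I : PartitionInstance J R) where
  parts : Finset (JobPart J I.m)
  /-- Nothing is processed before time `0`. -/
  start_nonneg : ∀ q ∈ parts, 0 ≤ q.start
  /-- Job parts have positive length. -/
  start_lt_finish : ∀ q ∈ parts, q.start < q.finish
  /-- A machine processes at most one job at a time. -/
  machine_disjoint : ∀ q ∈ parts, ∀ q' ∈ parts, q ≠ q' → q.machine = q'.machine →
    q.finish ≤ q'.start ∨ q'.finish ≤ q.start
  /-- Two jobs with the same resource are not processed at the same time, and
  no job is processed on two machines at the same time. -/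
  resource_disjoint : ∀ q ∈ parts, ∀ q' ∈ parts, q ≠ q' →
    I.resource q.job = I.resource q'.job → q.finish ≤ q'.start ∨ q'.finish ≤ q.start
  /-- The total amount of processing done on a job is its processing time. -/
  processing : ∀ j, ∑ q ∈ parts with q.job = j, (q.finish - q.start) = I.p j
  /-- Job parts are maximal: one part does not continue another one of the same job on the same
  machine without interruption. -/
  maximal : ∀ q ∈ parts, ∀ q' ∈ parts, q.job = q'.job → q.machine = q'.machine →
    q.finish ≠ q'.start

namespace PreemptiveSchedule

variable {J R : Type*} [DecidableEq J] {I : PartitionInstance J R}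

/-- The job parts of the job `j`. -/
def partsOf (s : PreemptiveSchedule I) (j : J) : Finset (JobPart J I.m) :=
  {q ∈ s.parts | q.job = j}

theorem partsOf_nonempty (s : PreemptiveSchedule I) (j : J) : (s.partsOf j).Nonempty := by
  rw [Finset.nonempty_iff_ne_empty]
  intro h
  have h1 := s.processing j
  have h2 := I.p_pos j
  unfold partsOf at h
  rw [h, Finset.sum_empty] at h1
  exact absurd h1 h2.ne

/-- The completion time `C_j`: the time at which the last part of `j` finishes. -/
noncomputable def completionTime (s : PreemptiveSchedule I) (j : J) : ℝ :=
  (s.partsOf j).sup' (s.partsOf_nonempty j) JobPart.finish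

/-- The objective `∑ C_j`. -/
noncomputable def totalCompletionTime [Fintype J] (s : PreemptiveSchedule I) : ℝ :=
  ∑ j, s.completionTime j

/-- `s` minimizes `∑ C_j` among all feasible preemptive schedules of the instance. -/
def IsOptimal [Fintype J] (s : PreemptiveSchedule I) : Prop :=
  ∀ s' : PreemptiveSchedule I, s.totalCompletionTime ≤ s'.totalCompletionTime

/-- `s` has no preemptions: each job is a single job part, that is, it is processed without
interruption on a single machine. -/
def IsNonpreemptive (s : PreemptiveSchedule I) : Prop :=
  ∀ j, ∃! q, q ∈ s.partsOf j

end PreemptiveSchedule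

open Filter Topology

/-! ### Feasible families of parts and elementary modifications -/

section Families

variable {J R ι : Type*} [DecidableEq J]

/-! Bound the number of parts by a finite index type. By compactness there is a vector of completion
times with minimum sum and, among these, maximum sum of squares. By strict convexity, a motion of
the parts that is feasible in both directions then moves no completion time
(`completion_velocity_eq_zero`).

Realise this vector by an inclusion-minimal set of parts, and swap remainders of machine schedules
until immediate successors with the same resource share a machine (`IsFeasible.exists_mach`). Every
motion whose velocity depends only on machine and time now respects all tight pairs.

If some job is preempted, let `a` be the latest-ending part that does not complete its job, and `z₀`
the last part of that job. At unit speed, delay everything on the machine of `a` from the end of `a`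
on, and advance everything on the machine of `z₀` from the end of `z₀` on; the job keeps its total
processing. Since no completion time may move, `a` and `z₀` share a machine, on which nothing starts
when `a` ends. So `a` alone can grow at the expense of the end of `z₀`, which lowers the sum: a
contradiction (`injOn_job_of_extremal`). -/

/-- A family of job parts indexed by `A`, with starting times `s` and finishing times `f`, that
is a preemptive schedule (up to maximality and positivity of the parts) in which every job `j`
finishes at time `C j` at the latest. -/
structure IsFeasible (I : PartitionInstance J R) (A : Finset ι) (job : ι → J) (mach : ι → Fin I.m)
    (s f : ι → ℝ) (C : J → ℝ) : Prop where
  start_nonneg : ∀ i ∈ A, 0 ≤ s i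
  start_le_finish : ∀ i ∈ A, s i ≤ f i
  finish_le : ∀ i ∈ A, f i ≤ C (job i)
  disjoint : ∀ i ∈ A, ∀ k ∈ A, i ≠ k →
    (mach i = mach k ∨ I.resource (job i) = I.resource (job k)) → f i ≤ s k ∨ f k ≤ s i
  processing : ∀ j, ∑ i ∈ A with job i = j, (f i - s i) = I.p j

/-- The upper bounds on the completion times that can be met with parts indexed by `ι`. -/
def achievable (I : PartitionInstance J R) (ι : Type*) : Set (J → ℝ) :=
  {C | ∃ (A : Finset ι) (job : ι → J) (mach : ι → Fin I.m) (s f : ι → ℝ),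
    IsFeasible I A job mach s f C}

variable {I : PartitionInstance J R} {A : Finset ι} {job : ι → J} {mach : ι → Fin I.m}
  {s f : ι → ℝ} {C : J → ℝ}

namespace IsFeasible

theorem exists_part (h : IsFeasible I A job mach s f C) (j : J) : ∃ i ∈ A, job i = j := by
  by_contra! hn
  have h1 := h.processing j
  rw [Finset.sum_eq_zero] at h1
  · exact (I.p_pos j).ne h1
  · intro i hi
    rw [Finset.mem_filter] at hi
    exact absurd hi.2 (hn i hi.1)

theorem completion_nonneg (h : IsFeasible I A job mach s f C) (j : J) : 0 ≤ C j := by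
  obtain ⟨i, hi, rfl⟩ := h.exists_part j
  exact (h.start_nonneg i hi).trans ((h.start_le_finish i hi).trans (h.finish_le i hi))

theorem congr (h : IsFeasible I A job mach s f C) {s' f' : ι → ℝ} (hs : ∀ i ∈ A, s' i = s i)
    (hf : ∀ i ∈ A, f' i = f i) : IsFeasible I A job mach s' f' C where
  start_nonneg i hi := by rw [hs i hi]; exact h.start_nonneg i hi
  start_le_finish i hi := by rw [hs i hi, hf i hi]; exact h.start_le_finish i hi
  finish_le i hi := by rw [hf i hi]; exact h.finish_le i hi
  disjoint i hi k hk := by rw [hs i hi, hf i hi, hs k hk, hf k hk]; exact h.disjoint i hi k hk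
  processing j := by
    rw [← h.processing j]
    refine Finset.sum_congr rfl fun i hi => ?_
    rw [hs i (Finset.mem_filter.1 hi).1, hf i (Finset.mem_filter.1 hi).1]

theorem eq_of_finish_eq (h : IsFeasible I A job mach s f C) (hpos : ∀ i ∈ A, s i < f i)
    {i k : ι} (hi : i ∈ A) (hk : k ∈ A)
    (hc : mach i = mach k ∨ I.resource (job i) = I.resource (job k)) (hf : f i = f k) : i = k := by
  by_contra hne
  have := hpos i hi
  have := hpos k hk
  rcases h.disjoint i hi k hk hne hc with h1 | h1 <;> linarith

theorem eq_of_start_eq (h : IsFeasible I A job mach s f C) (hpos : ∀ i ∈ A, s i < f i)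
    {i k : ι} (hi : i ∈ A) (hk : k ∈ A)
    (hc : mach i = mach k ∨ I.resource (job i) = I.resource (job k)) (hs : s i = s k) : i = k := by
  by_contra hne
  have := hpos i hi
  have := hpos k hk
  rcases h.disjoint i hi k hk hne hc with h1 | h1 <;> linarith

theorem erase_of_start_eq_finish [DecidableEq ι] (h : IsFeasible I A job mach s f C) {i : ι}
    (hi : s i = f i) : IsFeasible I (A.erase i) job mach s f C where
  start_nonneg k hk := h.start_nonneg k (Finset.mem_of_mem_erase hk)
  start_le_finish k hk := h.start_le_finish k (Finset.mem_of_mem_erase hk)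
  finish_le k hk := h.finish_le k (Finset.mem_of_mem_erase hk)
  disjoint k hk l hl := h.disjoint k (Finset.mem_of_mem_erase hk) l (Finset.mem_of_mem_erase hl)
  processing j := by
    rw [← h.processing j, Finset.filter_erase]
    exact Finset.sum_erase _ (by rw [hi, sub_self])

/-- Two parts of the same job of which one continues the other can be merged. -/
theorem merge [DecidableEq ι] (h : IsFeasible I A job mach s f C) (hpos : ∀ i ∈ A, s i < f i)
    {a b : ι} (ha : a ∈ A) (hb : b ∈ A) (hab : a ≠ b) (hjob : job a = job b)
    (hmach : mach a = mach b) (hfs : f a = s b) :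
    IsFeasible I (A.erase b) job mach s (Function.update f a (f b)) C where
  start_nonneg k hk := h.start_nonneg k (Finset.mem_of_mem_erase hk)
  start_le_finish k hk := by
    have hk' := Finset.mem_of_mem_erase hk
    rcases eq_or_ne k a with rfl | hne
    · rw [Function.update_self]
      linarith [hpos k hk', hpos b hb]
    · rw [Function.update_of_ne hne]
      exact h.start_le_finish k hk'
  finish_le k hk := by
    have hk' := Finset.mem_of_mem_erase hk
    rcases eq_or_ne k a with rfl | hne
    · rw [Function.update_self, hjob]
      exact h.finish_le b hb
    · rw [Function.update_of_ne hne]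
      exact h.finish_le k hk'
  disjoint := by
    have key : ∀ q ∈ A, q ≠ a → q ≠ b →
        (mach a = mach q ∨ I.resource (job a) = I.resource (job q)) → f b ≤ s q ∨ f q ≤ s a := by
      intro q hq hqa hqb hc
      have hq' := hpos q hq
      have h1 := h.disjoint a ha q hq hqa.symm hc
      rw [hmach, hjob] at hc
      have h2 := h.disjoint b hb q hq hqb.symm hc
      rcases h1 with h1 | h1
      · rcases h2 with h2 | h2
        · exact Or.inl h2
        · linarith
      · exact Or.inr h1
    intro k hk l hl hkl hc
    have hk' := Finset.mem_of_mem_erase hk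
    have hl' := Finset.mem_of_mem_erase hl
    rcases eq_or_ne k a with rfl | hka
    · rw [Function.update_self, Function.update_of_ne hkl.symm]
      exact key l hl' hkl.symm (Finset.ne_of_mem_erase hl) hc
    · rcases eq_or_ne l a with rfl | hla
      · rw [Function.update_self, Function.update_of_ne hka]
        exact (key k hk' hka (Finset.ne_of_mem_erase hk) (hc.imp Eq.symm Eq.symm)).symm
      · rw [Function.update_of_ne hka, Function.update_of_ne hla]
        exact h.disjoint k hk' l hl' hkl hc
  processing j := by
    rw [← h.processing j, Finset.sum_filter, Finset.sum_filter, ← Finset.add_sum_erase A _ hb,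
      ← Finset.add_sum_erase _ _ (Finset.mem_erase.2 ⟨hab, ha⟩),
      ← Finset.add_sum_erase (A.erase b) _ (Finset.mem_erase.2 ⟨hab, ha⟩), ← add_assoc]
    congr 1
    · rw [Function.update_self, hjob]
      split_ifs
      · rw [hfs]; ring
      · ring
    · refine Finset.sum_congr rfl fun i hi => ?_
      rw [Function.update_of_ne (Finset.ne_of_mem_erase hi)]

end IsFeasible

/-! ### Small perturbations: strict inequalities survive, tight ones depend on the velocities -/

theorem eventually_add_mul_le {a b u v : ℝ} (hab : a ≤ b) (huv : a = b → u ≤ v) :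
    ∀ᶠ ε in 𝓝[>] (0 : ℝ), a + ε * u ≤ b + ε * v := by
  rcases hab.eq_or_lt with h | h
  · filter_upwards [self_mem_nhdsWithin] with ε hε
    have := mul_le_mul_of_nonneg_left (huv h) (le_of_lt hε)
    linarith
  · have hc : Tendsto (fun ε : ℝ => b + ε * v - (a + ε * u)) (𝓝[>] 0)
        (𝓝 (b + 0 * v - (a + 0 * u))) :=
      Tendsto.mono_left (Continuous.tendsto (by fun_prop) 0) nhdsWithin_le_nhds
    filter_upwards [hc.eventually (lt_mem_nhds (a := 0) (by linarith))] with ε hε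
    linarith

/-- A family of parts can be moved a little with given velocities, as long as these respect the
constraints that hold with equality. -/
theorem IsFeasible.perturb [Finite ι] (h : IsFeasible I A job mach s f C)
    (hpos : ∀ i ∈ A, s i < f i) {vs vf : ι → ℝ} {vC : J → ℝ}
    (h0 : ∀ i ∈ A, s i = 0 → 0 ≤ vs i)
    (hC : ∀ i ∈ A, f i = C (job i) → vf i ≤ vC (job i))
    (htight : ∀ i ∈ A, ∀ k ∈ A, i ≠ k →
      (mach i = mach k ∨ I.resource (job i) = I.resource (job k)) → f i = s k → vf i ≤ vs k)
    (hsum : ∀ j, ∑ i ∈ A with job i = j, (vf i - vs i) = 0) :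
    ∀ᶠ ε in 𝓝[>] (0 : ℝ), IsFeasible I A job mach (fun i => s i + ε * vs i)
      (fun i => f i + ε * vf i) (fun j => C j + ε * vC j) := by
  have e1 : ∀ᶠ ε in 𝓝[>] (0 : ℝ), ∀ i, i ∈ A → 0 ≤ s i + ε * vs i := by
    rw [eventually_all]
    intro i
    rw [eventually_imp_distrib_left]
    intro hi
    have := eventually_add_mul_le (u := 0) (v := vs i) (h.start_nonneg i hi)
      (fun h' => h0 i hi h'.symm)
    simpa using this
  have e2 : ∀ᶠ ε in 𝓝[>] (0 : ℝ), ∀ i, i ∈ A → s i + ε * vs i ≤ f i + ε * vf i := by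
    rw [eventually_all]
    intro i
    rw [eventually_imp_distrib_left]
    intro hi
    exact eventually_add_mul_le (hpos i hi).le (fun h' => absurd h' (hpos i hi).ne)
  have e3 : ∀ᶠ ε in 𝓝[>] (0 : ℝ), ∀ i, i ∈ A →
      f i + ε * vf i ≤ C (job i) + ε * vC (job i) := by
    rw [eventually_all]
    intro i
    rw [eventually_imp_distrib_left]
    intro hi
    exact eventually_add_mul_le (h.finish_le i hi) (hC i hi)
  have e4 : ∀ᶠ ε in 𝓝[>] (0 : ℝ), ∀ i k, (i ∈ A ∧ k ∈ A ∧ i ≠ k ∧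
      (mach i = mach k ∨ I.resource (job i) = I.resource (job k))) →
      (f i + ε * vf i ≤ s k + ε * vs k ∨ f k + ε * vf k ≤ s i + ε * vs i) := by
    rw [eventually_all]
    intro i
    rw [eventually_all]
    intro k
    rw [eventually_imp_distrib_left]
    rintro ⟨hi, hk, hne, hc⟩
    rcases h.disjoint i hi k hk hne hc with h1 | h1
    · exact (eventually_add_mul_le h1 (htight i hi k hk hne hc)).mono fun _ => Or.inl
    · exact (eventually_add_mul_le h1
        (htight k hk i hi hne.symm (hc.imp Eq.symm Eq.symm))).mono fun _ => Or.inr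
  filter_upwards [e1, e2, e3, e4] with ε h1 h2 h3 h4
  refine ⟨h1, h2, h3, fun i hi k hk hne hc => h4 i k ⟨hi, hk, hne, hc⟩, fun j => ?_⟩
  have : ∀ i, f i + ε * vf i - (s i + ε * vs i) = (f i - s i) + ε * (vf i - vs i) :=
    fun i => by ring
  simp only [this]
  rw [Finset.sum_add_distrib, ← Finset.mul_sum, hsum, h.processing, mul_zero, add_zero]

/-! ### Interchanging the remainders of the schedules of two machines -/

/-- The pairs of parts with the same resource of which the second one starts on the same machine
at the time at which the first one finishes. -/
noncomputable def contacts (I : PartitionInstance J R) (A : Finset ι) (job : ι → J)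
    (s f : ι → ℝ) (mach : ι → Fin I.m) : Finset (ι × ι) :=
  open Classical in
  {x ∈ A ×ˢ A | f x.1 = s x.2 ∧ I.resource (job x.1) = I.resource (job x.2) ∧
    mach x.1 = mach x.2}

omit [DecidableEq J] in
theorem mem_contacts {x : ι × ι} : x ∈ contacts I A job s f mach ↔
    (x.1 ∈ A ∧ x.2 ∈ A) ∧ f x.1 = s x.2 ∧ I.resource (job x.1) = I.resource (job x.2) ∧
      mach x.1 = mach x.2 := by
  simp [contacts]

/-- Exchange the two machines from the time `f a` on. This puts `b` right behind `a` and destroys no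
contact. -/
theorem IsFeasible.exists_contacts_ssubset (h : IsFeasible I A job mach s f C)
    (hpos : ∀ i ∈ A, s i < f i) {a b : ι} (ha : a ∈ A) (hb : b ∈ A) (hab : f a = s b)
    (hres : I.resource (job a) = I.resource (job b)) (hmach : mach a ≠ mach b) :
    ∃ mach', IsFeasible I A job mach' s f C ∧
      contacts I A job s f mach ⊂ contacts I A job s f mach' := by
  set mach' : ι → Fin I.m := fun q =>
    if f a ≤ s q then Equiv.swap (mach a) (mach b) (mach q) else mach q with hmach'
  have late : ∀ q, f a ≤ s q → mach' q = Equiv.swap (mach a) (mach b) (mach q) :=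
    fun q hq => if_pos hq
  have early : ∀ q, s q < f a → mach' q = mach q := fun q hq => if_neg (not_le.2 hq)
  -- Neither machine has a part running across `f a`: `a` ends then on one, `b` starts then on the
  -- other.
  have cross : ∀ q ∈ A, s q < f a → mach q = mach a ∨ mach q = mach b → f q ≤ f a := by
    intro q hq hs hm
    have := hpos a ha
    have := hpos b hb
    rcases hm with hm | hm
    · rcases eq_or_ne q a with rfl | hne
      · exact le_rfl
      · rcases h.disjoint q hq a ha hne (Or.inl hm) with h1 | h1 <;> linarith
    · have hne : q ≠ b := by rintro rfl; linarith
      rcases h.disjoint q hq b hb hne (Or.inl hm) with h1 | h1 <;> linarith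
  have sep : ∀ q ∈ A, ∀ q' ∈ A, s q < f a → f a ≤ s q' → mach' q = mach' q' → q ≠ q' →
      f q ≤ s q' ∨ f q' ≤ s q := by
    intro q hq q' hq' hs hs' he hne
    by_cases hm : mach q = mach a ∨ mach q = mach b
    · exact Or.inl ((cross q hq hs hm).trans hs')
    · push Not at hm
      rw [early q hs, late q' hs'] at he
      refine h.disjoint q hq q' hq' hne (Or.inl ?_)
      have := congrArg (Equiv.swap (mach a) (mach b)) he
      rwa [Equiv.swap_apply_self, Equiv.swap_apply_of_ne_of_ne hm.1 hm.2] at this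
  refine ⟨mach', ⟨h.start_nonneg, h.start_le_finish, h.finish_le, ?_, h.processing⟩, ?_⟩
  · intro q hq q' hq' hne hc
    rcases hc with hc | hc
    · rcases lt_or_ge (s q) (f a) with h1 | h1
      · rcases lt_or_ge (s q') (f a) with h2 | h2
        · rw [early q h1, early q' h2] at hc
          exact h.disjoint q hq q' hq' hne (Or.inl hc)
        · exact sep q hq q' hq' h1 h2 hc hne
      · rcases lt_or_ge (s q') (f a) with h2 | h2
        · exact (sep q' hq' q hq h2 h1 hc.symm hne.symm).symm
        · rw [late q h1, late q' h2] at hc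
          exact h.disjoint q hq q' hq' hne (Or.inl (Equiv.injective _ hc))
    · exact h.disjoint q hq q' hq' hne (Or.inr hc)
  · rw [Finset.ssubset_iff_of_subset]
    · refine ⟨(a, b), mem_contacts.2 ⟨⟨ha, hb⟩, hab, hres, ?_⟩, fun hn => ?_⟩
      · rw [early a (hpos a ha), late b hab.le, Equiv.swap_apply_right]
      · exact hmach (mem_contacts.1 hn).2.2.2
    · rintro ⟨x, y⟩ hxy
      obtain ⟨⟨hx, hy⟩, hfs, hr, hm⟩ := mem_contacts.1 hxy
      refine mem_contacts.2 ⟨⟨hx, hy⟩, hfs, hr, ?_⟩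
      dsimp only at hx hy hfs hr hm ⊢
      have hx' := hpos x hx
      rcases lt_or_ge (s y) (f a) with h1 | h1
      · rw [early y h1, early x (by linarith), hm]
      · rcases lt_or_ge (s x) (f a) with h2 | h2
        -- A contact across `f a` on one of the two machines would be `(a, b)` itself: one member is
        -- determined by its machine, the other by its resource. But `a` and `b` are on different
        -- machines.
        · by_cases hm' : mach x = mach a ∨ mach x = mach b
          · have h3 : f x = f a := le_antisymm (cross x hx h2 hm') (by linarith)
            exfalso
            rcases hm' with hm' | hm'
            · have hxa : x = a := h.eq_of_finish_eq hpos hx ha (Or.inl hm') h3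
              subst hxa
              have hyb : y = b := h.eq_of_start_eq hpos hy hb (Or.inr (hr.symm.trans hres))
                (by linarith)
              subst hyb
              exact hmach hm
            · have hyb : y = b := h.eq_of_start_eq hpos hy hb (Or.inl (hm.symm.trans hm'))
                (by linarith)
              subst hyb
              have hxa : x = a := h.eq_of_finish_eq hpos hx ha (Or.inr (hr.trans hres.symm)) h3
              subst hxa
              exact hmach hm
          · push Not at hm'
            rw [early x h2, late y h1, ← hm, Equiv.swap_apply_of_ne_of_ne hm'.1 hm'.2]
        · rw [late x h2, late y h1, hm]

/-- The machines can be chosen such that parts with the same resource that follow one another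
immediately are on the same machine. -/
theorem IsFeasible.exists_mach [Finite ι] (h : IsFeasible I A job mach s f C)
    (hpos : ∀ i ∈ A, s i < f i) :
    ∃ mach', IsFeasible I A job mach' s f C ∧ ∀ a ∈ A, ∀ b ∈ A, f a = s b →
      I.resource (job a) = I.resource (job b) → mach' a = mach' b := by
  -- Among the finitely many feasible assignments of machines, one with the most contacts admits no
  -- further exchange.
  obtain ⟨mach', h', hmax⟩ := Set.exists_max_image {mach' | IsFeasible I A job mach' s f C}
    (fun mach' => (contacts I A job s f mach').card) (Set.toFinite _) ⟨mach, h⟩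
  refine ⟨mach', h', fun a ha b hb hab hres => ?_⟩
  by_contra hne
  obtain ⟨mach'', h'', hss⟩ := IsFeasible.exists_contacts_ssubset h' hpos ha hb hab hres hne
  exact absurd (hmax mach'' h'') (not_le.2 (Finset.card_lt_card hss))

/-! ### Compactness -/

/-- Here it matters that parts of length zero are admitted: every condition is an equation, a weak
inequality or a disjunction of two weak inequalities. -/
theorem isClosed_setOf_isFeasible :
    IsClosed {x : (ι → ℝ) × (ι → ℝ) × (J → ℝ) | IsFeasible I A job mach x.1 x.2.1 x.2.2} := by
  have : {x : (ι → ℝ) × (ι → ℝ) × (J → ℝ) | IsFeasible I A job mach x.1 x.2.1 x.2.2} =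
      {x | (∀ i ∈ A, 0 ≤ x.1 i) ∧ (∀ i ∈ A, x.1 i ≤ x.2.1 i) ∧
        (∀ i ∈ A, x.2.1 i ≤ x.2.2 (job i)) ∧
        (∀ i ∈ A, ∀ k ∈ A, i ≠ k →
          (mach i = mach k ∨ I.resource (job i) = I.resource (job k)) →
          x.2.1 i ≤ x.1 k ∨ x.2.1 k ≤ x.1 i) ∧
        ∀ j, ∑ i ∈ A with job i = j, (x.2.1 i - x.1 i) = I.p j} := by
    ext x
    exact ⟨fun h => ⟨h.1, h.2, h.3, h.4, h.5⟩, fun h => ⟨h.1, h.2.1, h.2.2.1, h.2.2.2.1, h.2.2.2.2⟩⟩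
  rw [this]
  simp only [Set.ofPred_and, Set.ofPred_forall, Set.ofPred_or]
  refine IsClosed.inter ?_ (IsClosed.inter ?_ (IsClosed.inter ?_ (IsClosed.inter ?_ ?_)))
  · exact isClosed_iInter fun i => isClosed_iInter fun _ =>
      isClosed_le (by fun_prop) (by fun_prop)
  · exact isClosed_iInter fun i => isClosed_iInter fun _ =>
      isClosed_le (by fun_prop) (by fun_prop)
  · exact isClosed_iInter fun i => isClosed_iInter fun _ =>
      isClosed_le (by fun_prop) (by fun_prop)
  · exact isClosed_iInter fun i => isClosed_iInter fun _ => isClosed_iInter fun k =>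
      isClosed_iInter fun _ => isClosed_iInter fun _ => isClosed_iInter fun _ =>
      (isClosed_le (by fun_prop) (by fun_prop)).union (isClosed_le (by fun_prop) (by fun_prop))
  · exact isClosed_iInter fun j => isClosed_eq (by fun_prop) (by fun_prop)

theorem isCompact_achievable [Fintype J] [Finite ι] (c : ℝ) :
    IsCompact {C ∈ achievable I ι | ∑ j, C j ≤ c} := by
  have hK : IsCompact (⋃ (A : Finset ι) (job : ι → J) (mach : ι → Fin I.m),
      (fun x : (ι → ℝ) × (ι → ℝ) × (J → ℝ) => x.2.2) ''
        ({x | IsFeasible I A job mach x.1 x.2.1 x.2.2} ∩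
          Set.Icc 0 (fun _ => c, fun _ => c, fun _ => c))) := by
    refine isCompact_iUnion fun A => isCompact_iUnion fun job => isCompact_iUnion fun mach => ?_
    refine IsCompact.image ?_ (by fun_prop)
    exact isCompact_Icc.inter_left isClosed_setOf_isFeasible
  have hcl : IsClosed {C : J → ℝ | ∑ j, C j ≤ c} := isClosed_le (by fun_prop) (by fun_prop)
  convert hK.inter_right hcl using 1
  ext C
  constructor
  · rintro ⟨⟨A, job, mach, s, f, h⟩, hc⟩
    refine ⟨?_, hc⟩
    classical
    have hCc : ∀ j, C j ≤ c := fun j =>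
      (Finset.single_le_sum (fun j _ => h.completion_nonneg j) (Finset.mem_univ j)).trans hc
    simp only [Set.mem_iUnion]
    by_cases hA : A.Nonempty
    · have hc0 : 0 ≤ c := by
        obtain ⟨i, hi⟩ := hA
        exact (h.completion_nonneg (job i)).trans (hCc _)
      have hs : ∀ i ∈ A, s i ≤ c := fun i hi =>
        (h.start_le_finish i hi).trans ((h.finish_le i hi).trans (hCc _))
      -- Times outside `A` are unconstrained; setting them to `0` places the family in the compact
      -- box.
      refine ⟨A, job, mach, (fun i => if i ∈ A then s i else 0, fun i => if i ∈ A then f i else 0, C),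
        ⟨h.congr (fun i hi => if_pos hi) (fun i hi => if_pos hi), ⟨?_, ?_, ?_⟩, ?_, ?_, ?_⟩, rfl⟩
      · intro i
        by_cases hi : i ∈ A
        · simpa [hi] using h.start_nonneg i hi
        · simp [hi]
      · intro i
        by_cases hi : i ∈ A
        · simpa [hi] using (h.start_nonneg i hi).trans (h.start_le_finish i hi)
        · simp [hi]
      · exact h.completion_nonneg
      · intro i
        by_cases hi : i ∈ A
        · simpa [hi] using hs i hi
        · simpa [hi] using hc0
      · intro i
        by_cases hi : i ∈ A
        · simpa [hi] using (h.finish_le i hi).trans (hCc _)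
        · simpa [hi] using hc0
      · exact hCc
    · have hJ : IsEmpty J := ⟨fun j => by
        obtain ⟨i, hi, -⟩ := h.exists_part j
        exact hA ⟨i, hi⟩⟩
      have hc0 : 0 ≤ c := by simpa using hc
      rw [Finset.not_nonempty_iff_eq_empty] at hA
      subst hA
      refine ⟨∅, job, mach, (0, 0, C), ⟨h.congr (by simp) (by simp),
        ⟨le_rfl, le_rfl, h.completion_nonneg⟩, fun _ => hc0, fun _ => hc0, hCc⟩, rfl⟩
  · rintro ⟨hC, hc⟩
    simp only [Set.mem_iUnion] at hC
    obtain ⟨A, job, mach, x, ⟨hx, -⟩, rfl⟩ := hC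
    exact ⟨⟨A, job, mach, x.1, x.2.1, hx⟩, hc⟩

/-- Among the achievable vectors with minimum sum there is one with maximum sum of squares. -/
theorem exists_extremal [Fintype J] [Finite ι] (hne : (achievable I ι).Nonempty) :
    ∃ C ∈ achievable I ι, (∀ C' ∈ achievable I ι, ∑ j, C j ≤ ∑ j, C' j) ∧
      ∀ C' ∈ achievable I ι, ∑ j, C' j = ∑ j, C j → ∑ j, C' j ^ 2 ≤ ∑ j, C j ^ 2 := by
  obtain ⟨C₀, hC₀⟩ := hne
  obtain ⟨C₁, ⟨hC₁, hle⟩, hmin⟩ := (isCompact_achievable (I := I) (ι := ι) (∑ j, C₀ j)).exists_isMinOn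
    ⟨C₀, hC₀, le_rfl⟩ (f := fun C => ∑ j, C j) (by fun_prop)
  have hmin' : ∀ C ∈ achievable I ι, ∑ j, C₁ j ≤ ∑ j, C j := by
    intro C hC
    rcases le_total (∑ j, C j) (∑ j, C₀ j) with h | h
    · exact hmin ⟨hC, h⟩
    · exact hle.trans h
  obtain ⟨C₂, ⟨hC₂, hle₂⟩, hmax⟩ := (isCompact_achievable (I := I) (ι := ι) (∑ j, C₁ j)).exists_isMaxOn
    ⟨C₁, hC₁, le_rfl⟩ (f := fun C => ∑ j, C j ^ 2) (by fun_prop)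
  have heq : ∑ j, C₂ j = ∑ j, C₁ j := le_antisymm hle₂ (hmin' C₂ hC₂)
  refine ⟨C₂, hC₂, fun C hC => heq.le.trans (hmin' C hC), fun C hC h => ?_⟩
  exact hmax ⟨hC, (h.trans heq).le⟩

/-! ### Extremal families have no preemptions -/

/-- A bound `C j` attained by no part could be lowered while all parts stay put. -/
theorem exists_finish_eq [Fintype J] [Finite ι] (h : IsFeasible I A job mach s f C)
    (hpos : ∀ i ∈ A, s i < f i) (hmin : ∀ C' ∈ achievable I ι, ∑ j, C j ≤ ∑ j, C' j) (j : J) :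
    ∃ i ∈ A, job i = j ∧ f i = C j := by
  by_contra! hn
  have hp := h.perturb hpos (vs := 0) (vf := 0) (vC := Pi.single j (-1)) (by simp)
    (fun i hi hf => by
      have hne : job i ≠ j := by
        rintro rfl
        exact hn i hi rfl hf
      simp [hne])
    (by simp) (by simp)
  obtain ⟨ε, hε, hε0⟩ := (hp.and self_mem_nhdsWithin).exists
  have h1 := hmin _ ⟨A, job, mach, _, _, hε⟩
  rw [Finset.sum_add_distrib, ← Finset.mul_sum, Finset.sum_pi_single'] at h1
  simp at h1
  exact absurd h1 (not_le.2 hε0)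

theorem completion_velocity_eq_zero [Fintype J] [Finite ι] (h : IsFeasible I A job mach s f C)
    (hpos : ∀ i ∈ A, s i < f i) (hmin : ∀ C' ∈ achievable I ι, ∑ j, C j ≤ ∑ j, C' j)
    (hmax : ∀ C' ∈ achievable I ι, ∑ j, C' j = ∑ j, C j → ∑ j, C' j ^ 2 ≤ ∑ j, C j ^ 2)
    {vs vf : ι → ℝ} {vC : J → ℝ}
    (h0 : ∀ i ∈ A, s i = 0 → vs i = 0)
    (hC : ∀ i ∈ A, f i = C (job i) → vf i = vC (job i))
    (htight : ∀ i ∈ A, ∀ k ∈ A, i ≠ k →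
      (mach i = mach k ∨ I.resource (job i) = I.resource (job k)) → f i = s k → vf i = vs k)
    (hsum : ∀ j, ∑ i ∈ A with job i = j, (vf i - vs i) = 0) (j : J) : vC j = 0 := by
  have e1 := h.perturb hpos (vs := vs) (vf := vf) (vC := vC) (fun i hi h' => (h0 i hi h').ge)
    (fun i hi h' => (hC i hi h').le) (fun i hi k hk hne hc h' => (htight i hi k hk hne hc h').le)
    hsum
  have e2 := h.perturb hpos (vs := -vs) (vf := -vf) (vC := -vC)
    (fun i hi h' => by simp [h0 i hi h']) (fun i hi h' => by simp [hC i hi h'])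
    (fun i hi k hk hne hc h' => by simp [htight i hi k hk hne hc h'])
    (fun j => by
      rw [← neg_eq_zero, ← Finset.sum_neg_distrib, ← hsum j]
      refine Finset.sum_congr rfl fun i _ => ?_
      simp only [Pi.neg_apply]
      ring)
  obtain ⟨ε, ⟨hε1, hε2⟩, hε0⟩ := ((e1.and e2).and self_mem_nhdsWithin).exists
  have hε0 : 0 < ε := hε0
  have m1 : _ ∈ achievable I ι := ⟨A, job, mach, _, _, hε1⟩
  have m2 : _ ∈ achievable I ι := ⟨A, job, mach, _, _, hε2⟩
  have s1 : ∑ j, (C j + ε * vC j) = ∑ j, C j + ε * ∑ j, vC j := by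
    rw [Finset.sum_add_distrib, Finset.mul_sum]
  have s2 : ∑ j, (C j + ε * (-vC) j) = ∑ j, C j - ε * ∑ j, vC j := by
    simp [Finset.sum_add_distrib, Finset.mul_sum, sub_eq_add_neg]
  have l1 := hmin _ m1
  have l2 := hmin _ m2
  rw [s1] at l1
  rw [s2] at l2
  have hz : ε * ∑ j, vC j = 0 := by linarith
  have q1 := hmax _ m1 (by rw [s1, hz, add_zero])
  have q2 := hmax _ m2 (by rw [s2, hz, sub_zero])
  -- Parallelogram identity: unless `vC` vanishes, one of the two opposite moves increases the sum
  -- of squares.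
  have q3 : ∑ j, (C j + ε * vC j) ^ 2 + ∑ j, (C j + ε * (-vC) j) ^ 2 =
      2 * ∑ j, C j ^ 2 + 2 * ε ^ 2 * ∑ j, vC j ^ 2 := by
    rw [Finset.mul_sum, Finset.mul_sum, ← Finset.sum_add_distrib, ← Finset.sum_add_distrib]
    refine Finset.sum_congr rfl fun j _ => ?_
    simp only [Pi.neg_apply]
    ring
  have q4 : 2 * ε ^ 2 * ∑ j, vC j ^ 2 ≤ 0 := by linarith
  have q5 : ∑ j, vC j ^ 2 ≤ 0 := by
    by_contra hn
    have : 0 < 2 * ε ^ 2 * ∑ j, vC j ^ 2 := mul_pos (by positivity) (not_le.1 hn)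
    linarith
  have q6 : vC j ^ 2 ≤ ∑ j, vC j ^ 2 :=
    Finset.single_le_sum (f := fun j => vC j ^ 2) (fun j _ => sq_nonneg _) (Finset.mem_univ j)
  exact pow_eq_zero_iff two_ne_zero |>.1 (le_antisymm (q6.trans q5) (sq_nonneg _))

theorem sum_filter_ite_sub_ite [DecidableEq ι] {a z : ι} (ha : a ∈ A) (hz : z ∈ A)
    (haz : job a = job z) (j : J) :
    ∑ i ∈ A with job i = j, ((if i = a then (1 : ℝ) else 0) - if i = z then 1 else 0) = 0 := by
  rw [Finset.sum_sub_distrib, Finset.sum_ite_eq', Finset.sum_ite_eq']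
  simp [ha, hz, haz]

/-- In an extremal family, in which parts with the same resource that follow one another
immediately are on the same machine and no two parts can be merged, every job has one part. -/
theorem injOn_job_of_extremal [Fintype J] [Finite ι] (h : IsFeasible I A job mach s f C)
    (hpos : ∀ i ∈ A, s i < f i) (hmin : ∀ C' ∈ achievable I ι, ∑ j, C j ≤ ∑ j, C' j)
    (hmax : ∀ C' ∈ achievable I ι, ∑ j, C' j = ∑ j, C j → ∑ j, C' j ^ 2 ≤ ∑ j, C j ^ 2)
    (hmach : ∀ a ∈ A, ∀ b ∈ A, f a = s b → I.resource (job a) = I.resource (job b) →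
      mach a = mach b)
    (hmerge : ∀ a ∈ A, ∀ b ∈ A, job a = job b → mach a = mach b → f a ≠ s b) :
    Set.InjOn job A := by
  classical
  have hfin := exists_finish_eq h hpos hmin
  choose z hzA hzjob hzC using hfin
  have hlast : ∀ i ∈ A, f i = C (job i) → i = z (job i) := fun i hi hf =>
    h.eq_of_finish_eq hpos hi (hzA _) (Or.inr (by rw [hzjob])) (hf.trans (hzC _).symm)
  suffices hfinal : ∀ i ∈ A, f i = C (job i) by
    intro i hi k hk hik
    rw [hlast i hi (hfinal i hi), hlast k hk (hfinal k hk), hik]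
  by_contra! hn
  obtain ⟨a₀, ha₀, hna₀⟩ := hn
  obtain ⟨a, ha, hamax⟩ := Finset.exists_max_image {i ∈ A | f i ≠ C (job i)} f
    ⟨a₀, Finset.mem_filter.2 ⟨ha₀, hna₀⟩⟩
  rw [Finset.mem_filter] at ha
  obtain ⟨haA, hna⟩ := ha
  have hfinal : ∀ i ∈ A, f a < f i → f i = C (job i) := by
    intro i hi hlt
    by_contra hne
    exact absurd (hamax i (Finset.mem_filter.2 ⟨hi, hne⟩)) (not_le.2 hlt)
  obtain ⟨z₀, hz₀⟩ : ∃ z₀, z₀ = z (job a) := ⟨_, rfl⟩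
  have hzA₀ : z₀ ∈ A := hz₀ ▸ hzA _
  have hjob : job a = job z₀ := by rw [hz₀, hzjob]
  have hzC₀ : f z₀ = C (job z₀) := by rw [← hjob, hz₀, hzC]
  have hazf : f a < f z₀ := by
    rw [hzC₀, ← hjob]
    exact lt_of_le_of_ne (h.finish_le a haA) hna
  have haz : a ≠ z₀ := by rintro rfl; exact lt_irrefl _ hazf
  have hposa := hpos a haA
  have hposz := hpos z₀ hzA₀
  -- Equality would put both parts on one machine, by `hmach`, where they could be merged.
  have has : f a < s z₀ := by
    rcases h.disjoint a haA z₀ hzA₀ haz (Or.inr (by rw [hjob])) with h1 | h1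
    · refine lt_of_le_of_ne h1 fun h2 => ?_
      exact hmerge a haA z₀ hzA₀ hjob (hmach a haA z₀ hzA₀ h2 (by rw [hjob])) h2
    · linarith
  have hsa := h.start_nonneg a haA
  -- The velocity at time `τ` on machine `M` if the first part grows at the expense of the last one
  set D : Fin I.m → ℝ → ℝ := fun M τ =>
    (if M = mach a ∧ f a ≤ τ then 1 else 0) - (if M = mach z₀ ∧ f z₀ ≤ τ then 1 else 0) with hD
  -- Shifting everything from `f b` on along the machine of `b` changes the length of `b` only: any
  -- other part there has both endpoints at or after `f b`, or neither.
  have hcross : ∀ b ∈ A, ∀ i ∈ A, ((if mach i = mach b ∧ f b ≤ f i then (1 : ℝ) else 0) -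
      (if mach i = mach b ∧ f b ≤ s i then 1 else 0)) = if i = b then 1 else 0 := by
    intro b hb i hi
    have hb' := hpos b hb
    have hi' := hpos i hi
    by_cases hib : i = b
    · subst hib
      simp [hi']
    · rw [if_neg hib]
      by_cases hm : mach i = mach b
      · rcases h.disjoint i hi b hb hib (Or.inl hm) with h1 | h1
        · rw [if_neg (fun h' => by linarith [h'.2]), if_neg (fun h' => by linarith [h'.2]), sub_zero]
        · rw [if_pos ⟨hm, by linarith⟩, if_pos ⟨hm, h1⟩, sub_self]
      · simp [hm]
  -- Tight pairs share machine and time, hence velocity; at time `0` the velocity vanishes because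
  -- `f a` and `f z₀` are positive.
  have hvel := completion_velocity_eq_zero h hpos hmin hmax (vs := fun i => D (mach i) (s i))
    (vf := fun i => D (mach i) (f i)) (vC := fun j => D (mach (z j)) (C j))
    (fun i hi h' => by
      simp only [hD, h']
      rw [if_neg (fun h' => by linarith [h'.2]), if_neg (fun h' => by linarith [h'.2]), sub_zero])
    (fun i hi h' => by
      rw [← hlast i hi h', h'])
    (fun i hi k hk hne hc h' => by
      have : mach i = mach k := hc.elim id (hmach i hi k hk h')
      rw [this, h'])
    (fun j => by
      rw [← sum_filter_ite_sub_ite haA hzA₀ hjob j]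
      refine Finset.sum_congr rfl fun i hi => ?_
      have hi' := (Finset.mem_filter.1 hi).1
      rw [← hcross a haA i hi', ← hcross z₀ hzA₀ i hi']
      simp only [hD]
      ring)
  have hvel' : ∀ i ∈ A, f i = C (job i) → D (mach i) (f i) = 0 := by
    intro i hi hf
    have := hvel (job i)
    rwa [← hlast i hi hf, ← hf] at this
  -- On another machine, `z₀` would end with velocity `-1`.
  have hmz : mach z₀ = mach a := by
    by_contra hne
    have := hvel' z₀ hzA₀ hzC₀
    simp [hD, hne] at this
  -- Such a `q` ends after `a`, so it completes its job, and it ends no later than `z₀` starts: this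
  -- completion time would have velocity `1`.
  have hidle : ∀ q ∈ A, mach q = mach a → s q ≠ f a := by
    intro q hq hm hs
    have hq' := hpos q hq
    have hqz : q ≠ z₀ := by rintro rfl; linarith
    rcases h.disjoint q hq z₀ hzA₀ hqz (Or.inl (hm.trans hmz.symm)) with h1 | h1
    · have := hvel' q hq (hfinal q hq (by linarith))
      simp only [hD] at this
      rw [if_pos ⟨hm, by linarith⟩, if_neg (fun h' => by linarith [h'.2])] at this
      norm_num at this
    · linarith
  -- Only the ends of `a` and `z₀` move now. A successor of `a` with the same resource would be on
  -- the same machine, so `hidle` excludes it too.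
  have hp := h.perturb hpos (vs := 0)
    (vf := fun i => (if i = a then (1 : ℝ) else 0) - if i = z₀ then 1 else 0)
    (vC := Pi.single (job z₀) (-1)) (by simp)
    (fun i hi hf => by
      have hia : i ≠ a := by rintro rfl; exact hna hf
      by_cases hj : job i = job z₀
      · have hiz : i = z₀ := by rw [hlast i hi hf, hj, ← hjob, hz₀]
        subst hiz
        simp [hia]
      · have hiz : i ≠ z₀ := by rintro rfl; exact hj rfl
        simp [hia, hiz, hj])
    (fun i hi k hk hne hc hf => by
      have hia : i ≠ a := by
        rintro rfl
        have hm : mach i = mach k := hc.elim id (hmach i hi k hk hf)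
        exact hidle k hk hm.symm hf.symm
      simp only [hia, if_false, Pi.zero_apply]
      split_ifs <;> norm_num)
    (fun j => by simpa using sum_filter_ite_sub_ite haA hzA₀ hjob j)
  obtain ⟨ε, hε, hε0⟩ := (hp.and self_mem_nhdsWithin).exists
  have h1 := hmin _ ⟨A, job, mach, _, _, hε⟩
  rw [Finset.sum_add_distrib, ← Finset.mul_sum, Finset.sum_pi_single'] at h1
  simp at h1
  exact absurd h1 (not_le.2 hε0)

/-! ### Existence of nonpreemptive minimisers -/

/-- The minimum of the sum of completion times is attained without preemptions. -/
theorem exists_nonpreemptive_of_achievable [Fintype J] [Finite ι]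
    (hne : (achievable I ι).Nonempty) :
    ∃ (C : J → ℝ) (mach : J → Fin I.m) (s f : J → ℝ),
      (∀ C' ∈ achievable I ι, ∑ j, C j ≤ ∑ j, C' j) ∧
      IsFeasible I Finset.univ id mach s f C := by
  classical
  obtain ⟨C, hC, hmin, hmax⟩ := exists_extremal hne
  obtain ⟨A, ⟨⟨job, mach₀, s, f, h₀⟩, hAmin⟩⟩ := Set.Finite.exists_minimal
    (s := {A : Finset ι | ∃ (job : ι → J) (mach : ι → Fin I.m) (s f : ι → ℝ),
      IsFeasible I A job mach s f C}) (Set.toFinite _) hC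
  -- Minimality of `A` excludes both parts of length zero and mergeable pairs.
  have herase : ∀ i ∈ A, ∀ (mach : ι → Fin I.m) (s f : ι → ℝ),
      ¬ IsFeasible I (A.erase i) job mach s f C := by
    intro i hi mach s f h
    have := hAmin ⟨job, mach, s, f, h⟩ (Finset.erase_subset i A)
    exact absurd (this hi) (Finset.notMem_erase i A)
  have hpos : ∀ i ∈ A, s i < f i := fun i hi =>
    lt_of_le_of_ne (h₀.start_le_finish i hi) fun he =>
      herase i hi _ _ _ (h₀.erase_of_start_eq_finish he)
  obtain ⟨mach, h, hmach⟩ := h₀.exists_mach hpos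
  have hinj := injOn_job_of_extremal h hpos hmin hmax hmach fun a ha b hb hj hm hf =>
    herase b hb _ _ _ (h.merge hpos ha hb
      (by rintro rfl; exact (hpos a ha).ne hf.symm) hj hm hf)
  choose i hiA hij using h.exists_part
  have hij' : ∀ k ∈ A, i (job k) = k := fun k hk => hinj (hiA _) hk (hij _)
  refine ⟨C, mach ∘ i, s ∘ i, f ∘ i, hmin, ⟨fun j _ => h.start_nonneg _ (hiA j),
    fun j _ => h.start_le_finish _ (hiA j), fun j _ => ?_, fun j _ k _ hjk hc => ?_, fun j => ?_⟩⟩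
  · have := h.finish_le _ (hiA j)
    rwa [hij] at this
  · refine h.disjoint _ (hiA j) _ (hiA k) (fun he => hjk ?_) ?_
    · rw [← hij j, he, hij]
    · rw [hij, hij]
      exact hc
  · rw [← h.processing j]
    have : ({k ∈ A | job k = j} : Finset ι) = {i j} := by
      ext k
      simp only [Finset.mem_filter, Finset.mem_singleton]
      constructor
      · rintro ⟨hk, rfl⟩
        exact (hij' k hk).symm
      · rintro rfl
        exact ⟨hiA j, hij j⟩
    rw [this]
    simp [Finset.filter_eq']

/-- Processing all jobs one after another on one machine is feasible. -/
theorem achievable_self_nonempty [Fintype J] : (achievable I J).Nonempty := by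
  classical
  let e := Fintype.equivFin J
  let s : J → ℝ := fun j => ∑ k with e k < e j, I.p k
  have hs : ∀ j, 0 ≤ s j := fun j => Finset.sum_nonneg fun k _ => (I.p_pos k).le
  have hle : ∀ j k, e j < e k → s j + I.p j ≤ s k := by
    intro j k hjk
    have hj : j ∉ ({l | e l < e j} : Finset J) := by simp
    rw [add_comm, ← Finset.sum_insert hj]
    refine Finset.sum_le_sum_of_subset_of_nonneg (fun l hl => ?_) fun l _ _ => (I.p_pos l).le
    rw [Finset.mem_insert, Finset.mem_filter] at hl
    rw [Finset.mem_filter]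
    rcases hl with rfl | hl
    · exact ⟨Finset.mem_univ _, hjk⟩
    · exact ⟨Finset.mem_univ _, hl.2.trans hjk⟩
  refine ⟨fun j => s j + I.p j, Finset.univ, id, fun _ => ⟨0, I.m_pos⟩, s, fun j => s j + I.p j,
    ⟨fun j _ => hs j, fun j _ => by linarith [I.p_pos j], fun j _ => le_rfl, fun j _ k _ hjk _ => ?_,
      fun j => ?_⟩⟩
  · rcases lt_or_gt_of_ne (fun h => hjk (e.injective h)) with h1 | h1
    · exact Or.inl (hle j k h1)
    · exact Or.inr (hle k j h1)
  · simp [Finset.filter_eq']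

end Families

/-! ### Passage between schedules and families -/

namespace PreemptiveSchedule

variable {J R : Type*} [DecidableEq J] {I : PartitionInstance J R}

theorem completionTime_mem_achievable (s : PreemptiveSchedule I) :
    s.completionTime ∈ achievable I s.parts := by
  refine ⟨Finset.univ, fun q => q.1.job, fun q => q.1.machine, fun q => q.1.start,
    fun q => q.1.finish, ⟨fun q _ => s.start_nonneg _ q.2, fun q _ => (s.start_lt_finish _ q.2).le,
      fun q _ => ?_, fun q _ q' _ hne hc => ?_, fun j => ?_⟩⟩
  · have hq : q.1 ∈ s.partsOf q.1.job := Finset.mem_filter.2 ⟨q.2, rfl⟩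
    exact Finset.le_sup' JobPart.finish hq
  · have hne' : q.1 ≠ q'.1 := fun h => hne (Subtype.ext h)
    rcases hc with hc | hc
    · exact s.machine_disjoint _ q.2 _ q'.2 hne' hc
    · exact s.resource_disjoint _ q.2 _ q'.2 hne' hc
  · rw [← s.processing j, Finset.sum_filter, Finset.sum_filter]
    exact Finset.sum_coe_sort s.parts (fun q => if q.job = j then q.finish - q.start else 0)

/-- A feasible family with one part for each job yields a schedule without preemptions. -/
theorem exists_of_isFeasible [Fintype J] {mach : J → Fin I.m} {s f C : J → ℝ}
    (h : IsFeasible I Finset.univ id mach s f C) :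
    ∃ S : PreemptiveSchedule I, S.IsNonpreemptive ∧ ∀ j, S.completionTime j ≤ C j := by
  classical
  let part : J → JobPart J I.m := fun j => ⟨j, mach j, s j, f j⟩
  have hlen : ∀ j, f j - s j = I.p j := by
    intro j
    rw [← h.processing j]
    simp [Finset.filter_eq']
  have hpos : ∀ j, s j < f j := fun j => by linarith [hlen j, I.p_pos j]
  have hparts : ∀ q, q ∈ Finset.univ.image part ↔ ∃ j, part j = q := by simp
  have hfilter : ∀ j, (Finset.univ.image part).filter (fun q => q.job = j) = {part j} := by
    intro j
    ext q
    rw [Finset.mem_filter, hparts, Finset.mem_singleton]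
    constructor
    · rintro ⟨⟨k, rfl⟩, rfl⟩
      rfl
    · rintro rfl
      exact ⟨⟨j, rfl⟩, rfl⟩
  let S : PreemptiveSchedule I :=
    { parts := Finset.univ.image part
      start_nonneg := by
        intro q hq
        obtain ⟨j, rfl⟩ := (hparts q).1 hq
        exact h.start_nonneg j (Finset.mem_univ j)
      start_lt_finish := by
        intro q hq
        obtain ⟨j, rfl⟩ := (hparts q).1 hq
        exact hpos j
      machine_disjoint := by
        intro q hq q' hq' hne hc
        obtain ⟨j, rfl⟩ := (hparts q).1 hq
        obtain ⟨k, rfl⟩ := (hparts q').1 hq'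
        exact h.disjoint j (Finset.mem_univ j) k (Finset.mem_univ k)
          (fun he => hne (congrArg part he)) (Or.inl hc)
      resource_disjoint := by
        intro q hq q' hq' hne hc
        obtain ⟨j, rfl⟩ := (hparts q).1 hq
        obtain ⟨k, rfl⟩ := (hparts q').1 hq'
        exact h.disjoint j (Finset.mem_univ j) k (Finset.mem_univ k)
          (fun he => hne (congrArg part he)) (Or.inr hc)
      processing := by
        intro j
        rw [hfilter, Finset.sum_singleton]
        exact hlen j
      maximal := by
        intro q hq q' hq' hj _ hf
        obtain ⟨j, rfl⟩ := (hparts q).1 hq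
        obtain ⟨k, rfl⟩ := (hparts q').1 hq'
        obtain rfl : j = k := hj
        exact (hpos j).ne hf.symm }
  have hpartsOf : ∀ j, S.partsOf j = {part j} := hfilter
  refine ⟨S, fun j => ⟨part j, ?_, fun q hq => ?_⟩, fun j => ?_⟩
  · rw [hpartsOf]
    exact Finset.mem_singleton_self _
  · rw [hpartsOf] at hq
    exact Finset.mem_singleton.1 hq
  · refine Finset.sup'_le _ _ fun q hq => ?_
    rw [hpartsOf] at hq
    rw [Finset.mem_singleton.1 hq]
    exact h.finish_le j (Finset.mem_univ j)

end PreemptiveSchedule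

theorem mainTheorem3 {J R : Type*} [Fintype J] [DecidableEq J] (I : PartitionInstance J R) :
    ∃ s : PreemptiveSchedule I, s.IsOptimal ∧ s.IsNonpreemptive := by
  obtain ⟨C, mach, s, f, hmin, h⟩ :=
    exists_nonpreemptive_of_achievable (achievable_self_nonempty (I := I))
  obtain ⟨S, hS, hSC⟩ := PreemptiveSchedule.exists_of_isFeasible h
  refine ⟨S, fun S' => ?_, hS⟩
  -- The number of parts of a competitor is not bounded in advance, so the result is applied again
  -- with the parts of `S'` as index type. The nonpreemptive family obtained is indexed by `J`,
  -- hence comparable with `C`.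
  obtain ⟨C', mach', s', f', hmin', h'⟩ :=
    exists_nonpreemptive_of_achievable ⟨_, S'.completionTime_mem_achievable⟩
  calc S.totalCompletionTime ≤ ∑ j, C j := Finset.sum_le_sum fun j _ => hSC j
    _ ≤ ∑ j, C' j := hmin _ ⟨_, _, _, _, _, h'⟩
    _ ≤ S'.totalCompletionTime := hmin' _ S'.completionTime_mem_achievable
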